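/- Let $\tau=(\tau_x)_{x\in\mathbb Z}$ be any trapping landscape with $\tau_x\in[1,\infty)$ for all $x\in\mathbb Z$. (If the $\tau_x$ are i.i.d. with $\mathbf P[\tau_0\ge u]=u^{-\alpha}$ for $u\ge 1$, where $\alpha>0$, this holds almost surely.) Let $X=(X_t)_{t\ge 0}$ be the symmetric Bouchaud trap model on $\mathbb Z$ in the landscape $\tau$, that is, the continuous-time Markov chain with generator $$\mathcal Lf(x)=\frac1{2\tau_x}\big(f(x+1)+f(x-1)-2f(x)\big).$$ Let $P^\tau_x$ be its law started from $x$, let $p^\tau_t(x,y)=P^\tau_x(X_t=y)/\tau_y$ be its heat kernel, and let $V(x,r)=\sum_{y\in\mathbb Z:\,|y-x|\le r}\tau_y$ for $x\in\mathbb Z$ and real $r\ge 0$. (i) For every $C<\infty$ there is a constant $c<\infty$, depending only on $C$, such that the following holds for all such $\tau$ and all $x\in\mathbb Z$. Let $V_l:[0,\infty)\to[0,\infty)$ be continuous, non-decreasing and not identically zero, with $V_l(2r)\le C\,V_l(r)$ and $V(x,r)\ge V_l(r)$ for all $r\ge 0$. Then $h_l(r):=rV_l(r)$ is a bijection of $[0,\infty)$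 onto itself, and $$p^\tau_t(x,x)\le \frac{c\,h_l^{-1}(t)}{t}\qquad\text{for all } t>0.$$ (ii) For every such $\tau$, every $x\in\mathbb Z$ and every integer $n\ge 1$, $$p^\tau_{2nV(x,n)}(x,x)\le\frac{2}{V(x,n-1)}.$$ (iii) For every such $\tau$, every $x\in\mathbb Z$ and every integer $n\ge 0$, $$p^\tau_{\frac n2V(x,n)}(x,x)\ge\frac{V(x,n)^2}{16\,V(x,2n)^3}.$$ -/

import Mathlib

open scoped NNReal
open MeasureTheory

namespace BTM

/-- The generator of the symmetric Bouchaud trap model on `ℤ` in the trapping landscape `τ`: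
`L f (x) = (1 / (2 τ_x)) ∑_{y ∼ x} (f y - f x)`, the neighbours of `x` being `x + 1`, `x - 1`. -/
noncomputable def generator (τ : ℤ → ℝ≥0) (f : ℤ → ℝ) (x : ℤ) : ℝ :=
  1 / (2 * (τ x : ℝ)) * ((f (x + 1) - f x) + (f (x - 1) - f x))

/-- `X` is, under the probability measure `P`, a Bouchaud trap model in the landscape `τ` started
from `x`: a continuous-time `ℤ`-valued process with right-continuous paths, with `X 0 = x` almost
surely, that solves the martingale problem for the generator `L`, i.e. for every bounded `f` the
process `f (X_t) - f (X_0) - ∫_0^t L f (X_s) ds` is a martingale for the filtration `ℱ`.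
When `τ ≥ 1` (so that the jump rates are bounded) this determines the law of `X`, which is the
quenched law of the Markov chain with generator `L`. -/
structure IsTrapModel {Ω : Type*} {mΩ : MeasurableSpace Ω} (τ : ℤ → ℝ≥0) (x : ℤ)
    (P : Measure Ω) (ℱ : Filtration ℝ≥0 mΩ) (X : ℝ≥0 → Ω → ℤ) : Prop where
  start : ∀ᵐ ω ∂P, X 0 ω = x
  adapted : ∀ t, Measurable[ℱ t] (X t)
  rightContinuous : ∀ ω t, ContinuousWithinAt (fun s => X s ω) (Set.Ici t) t
  martingale : ∀ f : ℤ → ℝ, (∃ K : ℝ, ∀ z, |f z| ≤ K) →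
    Martingale
      (fun (t : ℝ≥0) ω =>
        f (X t ω) - f (X 0 ω) - ∫ s in (0 : ℝ)..(t : ℝ), generator τ f (X s.toNNReal ω))
      ℱ P

/-- The heat kernel (transition density with respect to `∑_y τ_y δ_y`):
`p_t (x, y) = P_x (X_t = y) / τ_y`, where `P` is the law under which `X` starts from `x`. -/
noncomputable def heatKernel {Ω : Type*} {mΩ : MeasurableSpace Ω} (τ : ℤ → ℝ≥0)
    (P : Measure Ω) (X : ℝ≥0 → Ω → ℤ) (t : ℝ≥0) (y : ℤ) : ℝ :=
  P.real {ω | X t ω = y} / τ y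

/-- The volume `V (x, r) = ∑_{y ∈ ℤ, |y - x| ≤ r} τ_y` of the closed ball of radius `r ≥ 0`;
for `r = n` a natural number it is `∑_{y = x - n}^{x + n} τ_y`. -/
noncomputable def volume (τ : ℤ → ℝ≥0) (x : ℤ) (r : ℝ≥0) : ℝ≥0 :=
  ∑ y ∈ Finset.Icc (x - (⌊r⌋₊ : ℤ)) (x + (⌊r⌋₊ : ℤ)), τ y

end BTM

namespace BTM

open Filter Topology
open scoped InnerProductSpace

/-! ### Joint measurability and Dynkin's formula -/

section

variable {Ω : Type*} {mΩ : MeasurableSpace Ω} {τ : ℤ → ℝ≥0} {x : ℤ}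
    {P : Measure Ω} {ℱ : Filtration ℝ≥0 mΩ} {X : ℝ≥0 → Ω → ℤ}

/-! Put m_t(y) = P(X_t = y)/√τ_y. This is a curve in ℓ²(ℤ), and Dynkin's formula says that it solves
m' = S m weakly, where S = -½ D*D and Dv = ∇(τ^{-1/2} v). Since τ ≥ 1, S is bounded, so the equation
holds strongly and no semigroup has to be built. Symmetry of S makes ⟨m_s, m_{t-s}⟩ constant in s,
hence p_t(x,x) = ‖m_{t/2}‖², and this norm decays at the rate (‖m_s‖²)' = -‖D m_s‖².

Upper bounds (`heatKernel_le`): total mass at most 1 yields a y in the ball of radius N with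
p_s(x,y) ≤ 1/V(x,N), and Cauchy–Schwarz along the path from x to y gives (p_s(x,x) - p_s(x,y))² ≤ N
‖D m_s‖². So u = ‖m_s‖² - 1/V(x,N) satisfies u² ≤ -N u' wherever u ≥ 0, and integration gives
p_t(x,x) ≤ 1/V(x,N) + 2N/t. Parts (i) and (ii) are choices of N.

Lower bound (`le_heatKernel`): Cauchy–Schwarz gives P(X_s ∈ B)² ≤ p_{2s}(x,x) τ(B), with B the ball
of radius 2n. To see that X_s is still in B with probability at least 1/4, Dynkin's formula is
applied to an explicit function G supported in B with LG ≥ -1, G(x) ≥ (n+1)V(x,n) and G ≤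
(2n+1)V(x,n). -/

lemma IsTrapModel.measurable (h : IsTrapModel τ x P ℱ X) (t : ℝ≥0) : Measurable (X t) :=
  (h.adapted t).mono (ℱ.le t) le_rfl

/-- Right-continuity makes the process jointly measurable. -/
lemma IsTrapModel.measurable_uncurry (h : IsTrapModel τ x P ℱ X) :
    Measurable (fun p : ℝ≥0 × Ω => X p.1 p.2) := by
  -- The first point after s of the grid of mesh 1/(n+1). It approaches s from the right and depends
  -- on s only through a natural number, so each approximant is measurable.
  let a : ℕ → ℝ≥0 → ℝ≥0 := fun n s => ((⌊((n : ℝ≥0) + 1) * s⌋₊ : ℝ≥0) + 1) / ((n : ℝ≥0) + 1)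
  have ha_ge : ∀ n s, s ≤ a n s := fun n s => by
    have h1 : (0 : ℝ≥0) < (n : ℝ≥0) + 1 := by positivity
    rw [le_div_iff₀ h1, mul_comm]
    exact (Nat.lt_floor_add_one _).le
  have ha_le : ∀ n s, a n s ≤ s + 1 / ((n : ℝ≥0) + 1) := fun n s => by
    have h1 : (0 : ℝ≥0) < (n : ℝ≥0) + 1 := by positivity
    rw [div_le_iff₀ h1, add_mul _ _ ((n : ℝ≥0) + 1), div_mul_cancel₀ _ h1.ne', mul_comm s]
    gcongr
    exact Nat.floor_le (by positivity)
  have ha_lim : ∀ s, Tendsto (fun n => a n s) atTop (𝓝[≥] s) := fun s => by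
    refine tendsto_nhdsWithin_iff.2 ⟨?_, Eventually.of_forall fun n => ha_ge n s⟩
    refine tendsto_of_tendsto_of_tendsto_of_le_of_le tendsto_const_nhds ?_
      (fun n => ha_ge n s) (fun n => ha_le n s)
    have := (tendsto_const_nhds (x := s)).add
      (tendsto_one_div_add_atTop_nhds_zero_nat (𝕜 := ℝ≥0))
    simpa using this
  refine measurable_of_tendsto_metrizable (f := fun n (p : ℝ≥0 × Ω) => X (a n p.1) p.2) ?_ ?_
  · intro n
    obtain ⟨g, hg⟩ : ∃ g : ℕ → ℝ≥0, ∀ s, a n s = g ⌊((n : ℝ≥0) + 1) * s⌋₊ :=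
      ⟨fun k => ((k : ℝ≥0) + 1) / ((n : ℝ≥0) + 1), fun _ => rfl⟩
    simp only [hg]
    have h1 : Measurable (fun q : ℕ × Ω => X (g q.1) q.2) :=
      measurable_from_prod_countable_right fun k => (h.measurable (g k) :)
    have h2 : Measurable (fun p : ℝ≥0 × Ω => (⌊((n : ℝ≥0) + 1) * p.1⌋₊, p.2)) :=
      (Nat.measurable_floor.comp (measurable_fst.const_mul _)).prodMk measurable_snd
    exact h1.comp h2
  · rw [tendsto_pi_nhds]
    intro p
    exact (h.rightContinuous p.2 p.1).tendsto.comp (ha_lim p.1)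

lemma abs_generator_le (hτ : ∀ z, 1 ≤ τ z) {f : ℤ → ℝ} {K : ℝ} (hf : ∀ z, |f z| ≤ K) (z : ℤ) :
    |generator τ f z| ≤ 2 * K := by
  have h1 : (1 : ℝ) ≤ τ z := by exact_mod_cast hτ z
  have h2 : 1 / (2 * (τ z : ℝ)) ≤ 1 / 2 := by
    apply one_div_le_one_div_of_le <;> linarith
  have h3 := abs_le.1 (hf z)
  have h4 := abs_le.1 (hf (z + 1))
  have h5 := abs_le.1 (hf (z - 1))
  rw [generator, abs_mul, abs_of_nonneg (by positivity : (0 : ℝ) ≤ 1 / (2 * (τ z : ℝ)))]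
  calc 1 / (2 * (τ z : ℝ)) * |f (z + 1) - f z + (f (z - 1) - f z)|
      ≤ 1 / 2 * (4 * K) := by
        gcongr
        rw [abs_le]; constructor <;> linarith
    _ = 2 * K := by ring

lemma IsTrapModel.integrable_comp [IsProbabilityMeasure P] (h : IsTrapModel τ x P ℱ X)
    {f : ℤ → ℝ} {K : ℝ} (hf : ∀ z, |f z| ≤ K) (t : ℝ≥0) : Integrable (fun ω => f (X t ω)) P :=
  Integrable.of_bound ((measurable_from_top (f := f)).comp (h.measurable t)).aestronglyMeasurable K
    (Eventually.of_forall fun _ => hf _)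

lemma IsTrapModel.measurable_integral_comp [IsProbabilityMeasure P] (h : IsTrapModel τ x P ℱ X)
    (f : ℤ → ℝ) : Measurable (fun s : ℝ => ∫ ω, f (X s.toNNReal ω) ∂P) := by
  have h1 : Measurable (fun p : ℝ × Ω => f (X p.1.toNNReal p.2)) :=
    (measurable_from_top (f := f)).comp
      (h.measurable_uncurry.comp ((measurable_real_toNNReal.comp measurable_fst).prodMk
        measurable_snd))
  exact (h1.stronglyMeasurable.integral_prod_right (ν := P)).measurable

/-- Dynkin's formula at a fixed time. -/
lemma IsTrapModel.integral_comp_eq [IsProbabilityMeasure P] (h : IsTrapModel τ x P ℱ X)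
    (hτ : ∀ z, 1 ≤ τ z) {f : ℤ → ℝ} {K : ℝ} (hf : ∀ z, |f z| ≤ K) (t : ℝ≥0) :
    ∫ ω, f (X t ω) ∂P
      = f x + ∫ s in (0 : ℝ)..(t : ℝ), ∫ ω, generator τ f (X s.toNNReal ω) ∂P := by
  have hM := h.martingale f ⟨K, hf⟩
  have h0 := hM.setIntegral_eq (zero_le : 0 ≤ t) MeasurableSet.univ
  simp only [Measure.restrict_univ, NNReal.coe_zero, intervalIntegral.integral_same, sub_self,
    integral_zero] at h0
  have hjm : Measurable (fun p : ℝ × Ω => generator τ f (X p.1.toNNReal p.2)) :=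
    (measurable_from_top (f := generator τ f)).comp
      (h.measurable_uncurry.comp ((measurable_real_toNNReal.comp measurable_fst).prodMk
        measurable_snd))
  have : IsFiniteMeasure (MeasureTheory.volume.restrict (Set.uIoc (0 : ℝ) t)) :=
    ⟨by simp [Set.uIoc]⟩
  have hint : Integrable (Function.uncurry fun (s : ℝ) (ω : Ω) =>
      generator τ f (X s.toNNReal ω)) ((MeasureTheory.volume.restrict (Set.uIoc (0 : ℝ) t)).prod P) :=
    Integrable.of_bound hjm.aestronglyMeasurable (2 * K)
      (Eventually.of_forall fun p => abs_generator_le hτ hf _)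
  rw [intervalIntegral_integral_swap hint]
  have i1 := h.integrable_comp hf t
  have i2 := h.integrable_comp hf 0
  have i3 := hM.integrable t
  have i4 : Integrable (fun ω => ∫ s in (0 : ℝ)..(t : ℝ), generator τ f (X s.toNNReal ω)) P := by
    have := (i1.sub i2).sub i3
    refine this.congr (Eventually.of_forall fun ω => ?_)
    simp
  have h6 := integral_sub (i1.sub i2) i4
  have h7 := integral_sub i1 i2
  simp only [Pi.sub_apply] at h6
  have h5 : ∫ ω, f (X 0 ω) ∂P = f x := by
    have : ∀ᵐ ω ∂P, f (X 0 ω) = f x := h.start.mono fun ω hω => by rw [hω]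
    rw [integral_congr_ae this]; simp
  linarith

lemma IsTrapModel.hasSum_integral_comp [IsProbabilityMeasure P] (h : IsTrapModel τ x P ℱ X)
    {f : ℤ → ℝ} {K : ℝ} (hf : ∀ z, |f z| ≤ K) (t : ℝ≥0) :
    HasSum (fun y => P.real {ω | X t ω = y} * f y) (∫ ω, f (X t ω) ∂P) := by
  have hm := h.measurable t
  have hi : Integrable f (P.map (X t)) :=
    (integrable_map_measure (measurable_from_top.aestronglyMeasurable) hm.aemeasurable).2
      (h.integrable_comp hf t)
  rw [← integral_map hm.aemeasurable (f := f) (measurable_from_top.aestronglyMeasurable)]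
  have := hasSum_integral_iUnion (μ := P.map (X t)) (f := f) (s := fun y : ℤ => {y})
    (fun y => measurableSet_singleton y)
    (fun a b hab => by simpa using hab) hi.integrableOn
  simp only [Set.iUnion_of_singleton, Measure.restrict_univ, integral_singleton, smul_eq_mul,
    map_measureReal_apply hm (measurableSet_singleton _)] at this
  exact this

end

/-! ### From weak to strong solutions in a Hilbert space -/

section

/-- A bounded weak solution of `M' = S M` in a Hilbert space is a strong solution. -/
lemma continuous_and_hasDerivAt_of_weak_solution {H : Type*} [NormedAddCommGroup H]
    [InnerProductSpace ℝ H] [CompleteSpace H] (S : H →L[ℝ] H) (hS : ∀ u v, ⟪S u, v⟫_ℝ = ⟪u, S v⟫_ℝ)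
    (M : ℝ → H) (hb : ∀ t, ‖M t‖ ≤ 1) (hm : ∀ v, Measurable fun t => ⟪M t, v⟫_ℝ)
    (hd : ∀ v t, 0 ≤ t → ⟪M t, v⟫_ℝ = ⟪M 0, v⟫_ℝ + ∫ s in (0 : ℝ)..t, ⟪M s, S v⟫_ℝ)
    (h0 : ∀ t ≤ 0, M t = M 0) :
    Continuous M ∧ ∀ t, 0 < t → HasDerivAt M (S (M t)) t := by
  have hbd : ∀ v s, ‖⟪M s, v⟫_ℝ‖ ≤ ‖v‖ := fun v s =>
    (norm_inner_le_norm _ _).trans (by simpa using mul_le_mul_of_nonneg_right (hb s) (norm_nonneg v))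
  have hii : ∀ v a b, IntervalIntegrable (fun s => ⟪M s, v⟫_ℝ) MeasureTheory.volume a b := fun v a b => by
    refine (intervalIntegrable_const (c := ‖v‖)).mono_fun (hm v).aestronglyMeasurable
      (Eventually.of_forall fun s => ?_)
    simpa using hbd v s
  -- Testing the weak equation with v = M t - M s itself bounds ‖v‖² by ‖S‖ |t - s| ‖v‖. The
  -- resulting continuity makes the vector-valued integral of S (M s) meaningful.
  have hlip : ∀ s t, 0 ≤ s → 0 ≤ t → ‖M t - M s‖ ≤ ‖S‖ * |t - s| := fun s t hs ht => by
    have key : ⟪M t - M s, M t - M s⟫_ℝ ≤ ‖S‖ * |t - s| * ‖M t - M s‖ := by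
      generalize hv : M t - M s = v
      nth_rw 1 [← hv]
      rw [inner_sub_left, hd v t ht, hd v s hs, add_sub_add_left_eq_sub,
        intervalIntegral.integral_interval_sub_left (hii _ _ _) (hii _ _ _)]
      refine (le_abs_self _).trans ?_
      refine (intervalIntegral.norm_integral_le_of_norm_le_const (C := ‖S‖ * ‖v‖)
        fun r _ => (hbd _ r).trans (S.le_opNorm v)).trans (le_of_eq (by ring))
    rw [real_inner_self_eq_norm_sq] at key
    by_contra! hlt
    have : 0 < ‖M t - M s‖ := lt_of_le_of_lt (by positivity) hlt
    nlinarith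
  have hcont : Continuous M := by
    refine (LipschitzWith.of_dist_le_mul (K := ‖S‖₊) fun t s => ?_).continuous
    have e : ∀ t, M t = M (max t 0) := fun t => by
      rcases le_total t 0 with h | h
      · rw [max_eq_right h, h0 t h]
      · rw [max_eq_left h]
    rw [e t, e s, dist_eq_norm, Real.dist_eq]
    refine (hlip _ _ (le_max_right _ _) (le_max_right _ _)).trans ?_
    have := abs_max_sub_max_le_abs t s 0
    rw [coe_nnnorm]
    gcongr
  refine ⟨hcont, fun t ht => ?_⟩
  have hSc : Continuous fun s => S (M s) := S.continuous.comp hcont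
  have hrep : ∀ t, 0 ≤ t → M t = M 0 + ∫ s in (0 : ℝ)..t, S (M s) := fun t ht => by
    refine ext_inner_left ℝ fun v => ?_
    have h1 := (innerSL ℝ v).intervalIntegral_comp_comm
      (hSc.intervalIntegrable (μ := MeasureTheory.volume) 0 t)
    simp only [innerSL_apply_apply] at h1
    rw [inner_add_right, ← h1, real_inner_comm, hd v t ht, real_inner_comm]
    congr 1
    refine intervalIntegral.integral_congr fun s _ => ?_
    rw [← hS, real_inner_comm]
  have hder : HasDerivAt (fun t => M 0 + ∫ s in (0 : ℝ)..t, S (M s)) (S (M t)) t :=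
    (intervalIntegral.integral_hasDerivAt_right (hSc.intervalIntegrable _ _)
      (hSc.stronglyMeasurableAtFilter _ _) hSc.continuousAt).const_add _
  refine hder.congr_of_eventuallyEq ?_
  filter_upwards [lt_mem_nhds ht] with s hs using hrep s hs.le

end

/-! ### The law of the process as a curve in ℓ²(ℤ) -/

section

/-- Real square-summable sequences indexed by `ℤ`. -/
abbrev ell2 : Type := lp (fun _ : ℤ => ℝ) 2

lemma sum_norm_weight_mul_shift_le {w : ℤ → ℝ} (hw : ∀ z, |w z| ≤ 1) (k : ℤ) (v : ell2)
    (s : Finset ℤ) :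
    ∑ i ∈ s, ‖w (i + k) * v (i + k)‖ ^ (2 : ENNReal).toReal ≤ ‖v‖ ^ (2 : ENNReal).toReal := by
  refine le_trans ?_ (lp.sum_rpow_le_norm_rpow (by norm_num) v
    (s.map (Equiv.addRight k).toEmbedding))
  rw [Finset.sum_map]
  refine Finset.sum_le_sum fun i _ => ?_
  refine Real.rpow_le_rpow (norm_nonneg _) ?_ (by norm_num)
  rw [norm_mul]
  exact mul_le_of_le_one_left (norm_nonneg _) (hw _)

/-- Multiplication by a weight bounded by `1`, followed by the shift by `k`. -/
noncomputable def weightShift (w : ℤ → ℝ) (hw : ∀ z, |w z| ≤ 1) (k : ℤ) : ell2 →L[ℝ] ell2 :=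
  LinearMap.mkContinuous
    { toFun := fun v => ⟨fun i => w (i + k) * v (i + k),
        memℓp_gen' (sum_norm_weight_mul_shift_le hw k v)⟩
      map_add' := fun u v => by
        ext i
        exact mul_add _ _ _
      map_smul' := fun c v => by
        ext i
        simp [mul_left_comm] }
    1 fun v => by
      rw [one_mul]
      exact lp.norm_le_of_forall_sum_le (by norm_num) (norm_nonneg v)
        (sum_norm_weight_mul_shift_le hw k v)

@[simp] lemma weightShift_apply (w : ℤ → ℝ) (hw : ∀ z, |w z| ≤ 1) (k : ℤ) (v : ell2) (i : ℤ) :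
    weightShift w hw k v i = w (i + k) * v (i + k) := rfl

/-- The gradient of the weighted sequence `w v`. -/
noncomputable def weightedGrad (w : ℤ → ℝ) (hw : ∀ z, |w z| ≤ 1) : ell2 →L[ℝ] ell2 :=
  weightShift w hw 1 - weightShift w hw 0

@[simp] lemma weightedGrad_apply (w : ℤ → ℝ) (hw : ∀ z, |w z| ≤ 1) (v : ell2) (i : ℤ) :
    weightedGrad w hw v i = w (i + 1) * v (i + 1) - w i * v i := by
  simp [weightedGrad]

/-- The self-adjoint form of the generator on the flat space `ℓ²(ℤ)`. -/
noncomputable def flatGenerator (w : ℤ → ℝ) (hw : ∀ z, |w z| ≤ 1) : ell2 →L[ℝ] ell2 :=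
  -((1 / 2 : ℝ) • (ContinuousLinearMap.adjoint (weightedGrad w hw) ∘L weightedGrad w hw))

lemma inner_flatGenerator_right (w : ℤ → ℝ) (hw : ∀ z, |w z| ≤ 1) (u v : ell2) :
    ⟪u, flatGenerator w hw v⟫_ℝ = -(1 / 2 * ⟪weightedGrad w hw u, weightedGrad w hw v⟫_ℝ) := by
  simp [flatGenerator, inner_neg_right, inner_smul_right, ContinuousLinearMap.adjoint_inner_right]

lemma inner_flatGenerator_left (w : ℤ → ℝ) (hw : ∀ z, |w z| ≤ 1) (u v : ell2) :
    ⟪flatGenerator w hw u, v⟫_ℝ = ⟪u, flatGenerator w hw v⟫_ℝ := by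
  rw [real_inner_comm, inner_flatGenerator_right, inner_flatGenerator_right, real_inner_comm]

/-- The weight `τ^{-1/2}`. -/
noncomputable def invSqrt (τ : ℤ → ℝ≥0) (z : ℤ) : ℝ := (√(τ z : ℝ))⁻¹

lemma invSqrt_sq (τ : ℤ → ℝ≥0) (z : ℤ) : invSqrt τ z ^ 2 = (τ z : ℝ)⁻¹ := by
  rw [invSqrt, inv_pow, Real.sq_sqrt (NNReal.coe_nonneg _)]

lemma abs_invSqrt_le {τ : ℤ → ℝ≥0} (hτ : ∀ z, 1 ≤ τ z) (z : ℤ) : |invSqrt τ z| ≤ 1 := by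
  rw [invSqrt, abs_of_nonneg (by positivity)]
  exact inv_le_one_of_one_le₀ (Real.one_le_sqrt.2 (by exact_mod_cast hτ z))

variable {Ω : Type*} {mΩ : MeasurableSpace Ω} {τ : ℤ → ℝ≥0} {x : ℤ}
    {P : Measure Ω} {ℱ : Filtration ℝ≥0 mΩ} {X : ℝ≥0 → Ω → ℤ}

/-- With q = P(Y = y) ≤ 1 and τ_y ≥ 1, each term q²/τ_y is at most q, and the q's sum to at most 1.
-/
lemma sum_norm_occupation_le [IsProbabilityMeasure P] (hτ : ∀ z, 1 ≤ τ z) {Y : Ω → ℤ}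
    (hY : Measurable Y) (s : Finset ℤ) :
    ∑ y ∈ s, ‖P.real {ω | Y ω = y} * invSqrt τ y‖ ^ (2 : ENNReal).toReal
      ≤ 1 ^ (2 : ENNReal).toReal := by
  have h1 : ∑ y ∈ s, P.real {ω | Y ω = y} ≤ 1 := by
    rw [← measureReal_biUnion_finset]
    · exact measureReal_le_one
    · intro a _ b _ hab
      refine Set.disjoint_left.2 fun ω (h : Y ω = a) (h' : Y ω = b) => hab (h.symm.trans h')
    · exact fun b _ => hY (measurableSet_singleton b)
  rw [Real.one_rpow]
  refine le_trans (Finset.sum_le_sum fun y _ => ?_) h1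
  have h2 : P.real {ω | Y ω = y} ≤ 1 := measureReal_le_one
  have h3 : 0 ≤ P.real {ω | Y ω = y} := measureReal_nonneg
  have h4 := abs_invSqrt_le hτ y
  simp only [ENNReal.toReal_ofNat, Real.rpow_ofNat, norm_mul, Real.norm_eq_abs, abs_of_nonneg h3]
  calc (P.real {ω | Y ω = y} * |invSqrt τ y|) ^ 2
      ≤ (P.real {ω | Y ω = y} * 1) ^ 2 := by gcongr
    _ ≤ P.real {ω | Y ω = y} := by nlinarith

/-- The law of `Y` as the square-summable sequence `y ↦ P (Y = y) / √τ_y`. -/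
noncomputable def occupation [IsProbabilityMeasure P] (hτ : ∀ z, 1 ≤ τ z) {Y : Ω → ℤ}
    (hY : Measurable Y) : ell2 :=
  ⟨fun y => P.real {ω | Y ω = y} * invSqrt τ y, memℓp_gen' (sum_norm_occupation_le hτ hY)⟩

lemma occupation_apply [IsProbabilityMeasure P] (hτ : ∀ z, 1 ≤ τ z) {Y : Ω → ℤ}
    (hY : Measurable Y) (y : ℤ) :
    occupation (P := P) hτ hY y = P.real {ω | Y ω = y} * invSqrt τ y := rfl

lemma norm_occupation_le [IsProbabilityMeasure P] (hτ : ∀ z, 1 ≤ τ z) {Y : Ω → ℤ}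
    (hY : Measurable Y) : ‖occupation (P := P) hτ hY‖ ≤ 1 :=
  lp.norm_le_of_forall_sum_le (by norm_num) zero_le_one (sum_norm_occupation_le hτ hY)

lemma abs_apply_le_norm (v : ell2) (z : ℤ) : |v z| ≤ ‖v‖ := lp.norm_apply_le_norm (by norm_num) v z

lemma abs_invSqrt_mul_le (hτ : ∀ z, 1 ≤ τ z) (v : ell2) (z : ℤ) :
    |invSqrt τ z * v z| ≤ ‖v‖ := by
  rw [abs_mul]
  exact (mul_le_of_le_one_left (abs_nonneg _) (abs_invSqrt_le hτ z)).trans (abs_apply_le_norm v z)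

lemma IsTrapModel.inner_occupation [IsProbabilityMeasure P] (h : IsTrapModel τ x P ℱ X)
    (hτ : ∀ z, 1 ≤ τ z) (t : ℝ≥0) (v : ell2) :
    ⟪occupation (P := P) hτ (h.measurable t), v⟫_ℝ = ∫ ω, invSqrt τ (X t ω) * v (X t ω) ∂P := by
  have h1 := h.hasSum_integral_comp (abs_invSqrt_mul_le hτ v) t
  refine (lp.hasSum_inner (𝕜 := ℝ) _ v).unique (h1.congr_fun fun y => ?_)
  simp [occupation_apply]
  ring

lemma generator_eq (τ : ℤ → ℝ≥0) (hw : ∀ z, |invSqrt τ z| ≤ 1) (v : ell2) (z : ℤ) :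
    generator τ (fun z => invSqrt τ z * v z) z = 1 / 2 * invSqrt τ z ^ 2 *
      (weightedGrad (invSqrt τ) hw v z - weightedGrad (invSqrt τ) hw v (z - 1)) := by
  rw [generator, invSqrt_sq]
  simp
  ring

/-- Summation by parts. -/
lemma IsTrapModel.inner_occupation_flatGenerator [IsProbabilityMeasure P]
    (h : IsTrapModel τ x P ℱ X) (hτ : ∀ z, 1 ≤ τ z) (t : ℝ≥0) (v : ell2) :
    ⟪occupation (P := P) hτ (h.measurable t), flatGenerator _ (abs_invSqrt_le hτ) v⟫_ℝ =
      ∫ ω, generator τ (fun z => invSqrt τ z * v z) (X t ω) ∂P := by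
  have hw := abs_invSqrt_le hτ
  have h1 := h.hasSum_integral_comp (abs_generator_le hτ (abs_invSqrt_mul_le hτ v)) t
  rw [inner_flatGenerator_right]
  set m := occupation (P := P) hτ (h.measurable t) with hm
  set d := weightedGrad _ hw v with hd
  have h2 := lp.hasSum_inner (𝕜 := ℝ) (weightShift _ hw 0 m) d
  have h3 := lp.hasSum_inner (𝕜 := ℝ) (weightShift _ hw 1 m) d
  -- Shifting the index by one puts the factor of m at the same site y in both sums, leaving d y and
  -- d (y - 1) as in `generator_eq`.
  rw [← (Equiv.subRight (1 : ℤ)).hasSum_iff] at h3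
  have h4 : ⟪weightedGrad _ hw m, d⟫_ℝ = ⟪weightShift _ hw 1 m, d⟫_ℝ - ⟪weightShift _ hw 0 m, d⟫_ℝ := by
    rw [weightedGrad, sub_apply, inner_sub_left]
  rw [h4]
  refine (((h3.sub h2).mul_left (1 / 2)).neg).unique (h1.congr_fun fun y => ?_)
  simp [generator_eq τ hw, ← hd, hm, occupation_apply]
  ring

/-- The evolution of the law as a curve in `ℓ²(ℤ)`. -/
noncomputable def IsTrapModel.curve [IsProbabilityMeasure P] (h : IsTrapModel τ x P ℱ X)
    (hτ : ∀ z, 1 ≤ τ z) (t : ℝ) : ell2 := occupation (P := P) hτ (h.measurable t.toNNReal)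

lemma IsTrapModel.curve_continuous_and_hasDerivAt [IsProbabilityMeasure P]
    (h : IsTrapModel τ x P ℱ X) (hτ : ∀ z, 1 ≤ τ z) :
    Continuous (h.curve hτ) ∧ ∀ t, 0 < t →
      HasDerivAt (h.curve hτ) (flatGenerator _ (abs_invSqrt_le hτ) (h.curve hτ t)) t := by
  refine continuous_and_hasDerivAt_of_weak_solution _ (inner_flatGenerator_left _ _) _
    (fun t => norm_occupation_le _ _) (fun v => ?_) (fun v t ht => ?_) (fun t ht => ?_)
  · simp only [curve, h.inner_occupation hτ]
    exact h.measurable_integral_comp (fun z => invSqrt τ z * v z)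
  · simp only [curve, h.inner_occupation_flatGenerator hτ]
    simp only [h.inner_occupation hτ]
    have h1 := h.integral_comp_eq hτ (abs_invSqrt_mul_le hτ v) t.toNNReal
    have h2 := h.integral_comp_eq hτ (abs_invSqrt_mul_le hτ v) 0
    simp only [NNReal.coe_zero, intervalIntegral.integral_same, add_zero] at h2
    rw [Real.toNNReal_zero, h1, h2, Real.coe_toNNReal t ht]
  · simp only [curve, Real.toNNReal_zero, Real.toNNReal_of_nonpos ht]

end

/-! ### Energy decay and the upper bound -/

section

variable {Ω : Type*} {mΩ : MeasurableSpace Ω} {τ : ℤ → ℝ≥0} {x : ℤ}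
    {P : Measure Ω} {ℱ : Filtration ℝ≥0 mΩ} {X : ℝ≥0 → Ω → ℤ}

section Curve

variable [IsProbabilityMeasure P] (h : IsTrapModel τ x P ℱ X) (hτ : ∀ z, 1 ≤ τ z)


lemma IsTrapModel.weighted_curve_apply (t : ℝ≥0) (y : ℤ) :
    invSqrt τ y * h.curve hτ t y = heatKernel τ P X t y := by
  rw [heatKernel, curve, occupation_apply, Real.toNNReal_coe, div_eq_mul_inv, ← invSqrt_sq]
  ring

/-- The initial vector is δ_x/√τ_x, so pairing with it turns m_t into p_t(x,x). -/
lemma IsTrapModel.inner_curve_zero (v : ell2) :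
    ⟪h.curve hτ 0, v⟫_ℝ = invSqrt τ x * v x := by
  have h2 := h.integral_comp_eq hτ (abs_invSqrt_mul_le hτ v) 0
  rw [curve, h.inner_occupation hτ, Real.toNNReal_zero, h2]
  simp

/-- Chapman–Kolmogorov on the diagonal. -/
lemma IsTrapModel.heatKernel_eq_norm_sq (t : ℝ≥0) :
    heatKernel τ P X t x = ‖h.curve hτ (t / 2)‖ ^ 2 := by
  rcases eq_zero_or_pos t with rfl | ht
  · rw [NNReal.coe_zero, zero_div, ← real_inner_self_eq_norm_sq, h.inner_curve_zero hτ,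
      ← h.weighted_curve_apply hτ, NNReal.coe_zero]
  obtain ⟨hc, hd⟩ := h.curve_continuous_and_hasDerivAt hτ
  set M := h.curve hτ
  have htr : (0 : ℝ) < t := ht
  -- The two terms of the derivative, ⟨S M_s, M_{t-s}⟩ and -⟨M_s, S M_{t-s}⟩, cancel by symmetry of
  -- S. The endpoint values of this constant function are then compared.
  have hk : ∀ s ∈ Set.Ioo (0 : ℝ) (t / 2), HasDerivAt (fun s => ⟪M s, M (t - s)⟫_ℝ) 0 s := by
    intro s hs
    have h1 := hd s hs.1
    have h2 := (hd (t - s) (by linarith [hs.2])).comp_const_sub (t : ℝ) s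
    have h3 := h1.inner ℝ h2
    rwa [inner_neg_right, inner_flatGenerator_left, neg_add_cancel] at h3
  obtain ⟨c, hc1, hc2⟩ := exists_hasDerivAt_eq_slope (fun s => ⟪M s, M (t - s)⟫_ℝ) (fun _ => 0)
    (half_pos htr) (by fun_prop) hk
  have h4 : ⟪M (t / 2), M (t - t / 2)⟫_ℝ = ⟪M 0, M (t - 0)⟫_ℝ := by
    rw [eq_comm, div_eq_iff (by linarith)] at hc2
    linarith
  rw [sub_half, real_inner_self_eq_norm_sq, sub_zero, h.inner_curve_zero hτ,
    h.weighted_curve_apply hτ] at h4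
  exact h4.symm

lemma IsTrapModel.hasDerivAt_norm_sq_curve {s : ℝ} (hs : 0 < s) :
    HasDerivAt (fun s => ‖h.curve hτ s‖ ^ 2)
      (-‖weightedGrad _ (abs_invSqrt_le hτ) (h.curve hτ s)‖ ^ 2) s := by
  convert ((h.curve_continuous_and_hasDerivAt hτ).2 s hs).norm_sq using 1
  rw [inner_flatGenerator_right, real_inner_self_eq_norm_sq]
  ring

lemma IsTrapModel.antitoneOn_norm_sq_curve :
    AntitoneOn (fun s => ‖h.curve hτ s‖ ^ 2) (Set.Ici 0) := by
  refine antitoneOn_of_hasDerivWithinAt_nonpos (convex_Ici 0)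
    ((h.curve_continuous_and_hasDerivAt hτ).1.norm.pow 2).continuousOn
    (f' := fun s => -‖weightedGrad _ (abs_invSqrt_le hτ) (h.curve hτ s)‖ ^ 2)
    (fun s hs => ?_) (fun s _ => by simp)
  rw [interior_Ici] at hs
  exact (h.hasDerivAt_norm_sq_curve hτ hs).hasDerivWithinAt

end Curve

/-- Telescope over the k edges from a to a + k and apply Cauchy–Schwarz: effective resistance is at
most distance. -/
lemma sq_sub_le_mul_norm_weightedGrad_sq {w : ℤ → ℝ} (hw : ∀ z, |w z| ≤ 1) (v : ell2) (a : ℤ)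
    (k : ℕ) :
    (w (a + k) * v (a + k) - w a * v a) ^ 2 ≤ k * ‖weightedGrad w hw v‖ ^ 2 := by
  have h1 : w (a + k) * v (a + k) - w a * v a
      = ∑ i ∈ Finset.range k, weightedGrad w hw v (a + i) := by
    have := Finset.sum_range_sub (fun i : ℕ => w (a + i) * v (a + i)) k
    simp only [Nat.cast_zero, add_zero] at this
    rw [← this]
    refine Finset.sum_congr rfl fun i _ => ?_
    simp [add_assoc]
  rw [h1]
  refine sq_sum_le_card_mul_sum_sq.trans ?_
  rw [Finset.card_range]
  gcongr
  have h2 := lp.sum_rpow_le_norm_rpow (p := 2) (by norm_num) (weightedGrad w hw v)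
    ((Finset.range k).map ⟨fun i : ℕ => a + (i : ℤ), fun i j hij => by simpa using hij⟩)
  rw [Finset.sum_map] at h2
  simp only [ENNReal.toReal_ofNat, Real.rpow_ofNat, Real.norm_eq_abs, sq_abs] at h2
  exact h2

lemma sq_sub_le_of_abs_sub_le {w : ℤ → ℝ} (hw : ∀ z, |w z| ≤ 1) (v : ell2) {a b : ℤ}
    {N : ℕ} (hab : |b - a| ≤ N) :
    (w a * v a - w b * v b) ^ 2 ≤ N * ‖weightedGrad w hw v‖ ^ 2 := by
  have key : ∀ c d : ℤ, c ≤ d → d - c ≤ N →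
      (w d * v d - w c * v c) ^ 2 ≤ N * ‖weightedGrad w hw v‖ ^ 2 := fun c d hcd hN => by
    obtain ⟨k, rfl⟩ := Int.le.dest hcd
    have hk : (k : ℝ) ≤ N := by
      have : k ≤ N := by omega
      exact_mod_cast this
    refine (sq_sub_le_mul_norm_weightedGrad_sq hw v c k).trans ?_
    gcongr
  rw [abs_le] at hab
  rcases le_total a b with hle | hle
  · rw [← neg_sq, neg_sub]
    exact key a b hle hab.2
  · exact key b a hle (by linarith [hab.1])

lemma volume_natCast (τ : ℤ → ℝ≥0) (x : ℤ) (N : ℕ) :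
    (volume τ x N : ℝ) = ∑ y ∈ Finset.Icc (x - (N : ℤ)) (x + N), (τ y : ℝ) := by
  simp [volume]

lemma volume_mono (τ : ℤ → ℝ≥0) (x : ℤ) : Monotone (volume τ x) := by
  intro a b hab
  have : ⌊a⌋₊ ≤ ⌊b⌋₊ := Nat.floor_mono hab
  refine Finset.sum_le_sum_of_subset (Finset.Icc_subset_Icc ?_ ?_) <;> omega

lemma volume_pos (hτ : ∀ z, 1 ≤ τ z) (x : ℤ) (r : ℝ≥0) : 0 < volume τ x r :=
  Finset.sum_pos (fun y _ => zero_lt_one.trans_le (hτ y)) ⟨x, by simp⟩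

lemma IsTrapModel.sum_heatKernel_mul_le_one [IsProbabilityMeasure P] (h : IsTrapModel τ x P ℱ X)
    (hτ : ∀ z, 1 ≤ τ z) (t : ℝ≥0) (s : Finset ℤ) : ∑ y ∈ s, heatKernel τ P X t y * τ y ≤ 1 := by
  have h1 : ∀ y, heatKernel τ P X t y * τ y = P.real {ω | X t ω = y} := fun y =>
    div_mul_cancel₀ _ (zero_lt_one.trans_le (show (1 : ℝ) ≤ τ y from hτ y)).ne'
  simp only [h1]
  rw [← measureReal_biUnion_finset]
  · exact measureReal_le_one
  · intro a _ b _ hab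
    refine Set.disjoint_left.2 fun ω (h : X t ω = a) (h' : X t ω = b) => hab (h.symm.trans h')
  · exact fun b _ => h.measurable t (measurableSet_singleton b)

/-- Averaging: if p exceeded 1/V on the whole ball, its τ-mass there would exceed 1. -/
lemma IsTrapModel.exists_heatKernel_le [IsProbabilityMeasure P] (h : IsTrapModel τ x P ℱ X)
    (hτ : ∀ z, 1 ≤ τ z) (t : ℝ≥0) (N : ℕ) :
    ∃ y : ℤ, |y - x| ≤ N ∧ heatKernel τ P X t y ≤ 1 / volume τ x N := by
  have hV : (0 : ℝ) < volume τ x N := volume_pos hτ x N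
  have h1 : ∑ y ∈ Finset.Icc (x - (N : ℤ)) (x + N), heatKernel τ P X t y * τ y
      ≤ ∑ y ∈ Finset.Icc (x - (N : ℤ)) (x + N), 1 / volume τ x N * (τ y : ℝ) := by
    rw [← Finset.mul_sum, ← volume_natCast, one_div, inv_mul_cancel₀ hV.ne']
    exact h.sum_heatKernel_mul_le_one hτ t _
  obtain ⟨y, hy, hle⟩ := Finset.exists_le_of_sum_le ⟨x, by simp⟩ h1
  refine ⟨y, ?_, le_of_mul_le_mul_right hle (zero_lt_one.trans_le (show (1 : ℝ) ≤ τ y from hτ y))⟩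
  rw [Finset.mem_Icc] at hy
  rw [abs_le]
  constructor <;> linarith [hy.1, hy.2]

/-- If `u' ≤ -u² / N` on `(0, ∞)` in the form `u² ≤ N g`, `u' = -g`, then `u(s) ≤ N / s`. -/
lemma le_div_of_sq_le_mul_neg_deriv {u g : ℝ → ℝ} {N : ℝ} (hN : 0 ≤ N)
    (hc : ContinuousOn u (Set.Ici 0)) (hd : ∀ s, 0 < s → HasDerivAt u (-g s) s)
    (hu : ∀ s, 0 < s → 0 ≤ u s → u s ^ 2 ≤ N * g s) (hanti : AntitoneOn u (Set.Ici 0))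
    {s : ℝ} (hs : 0 < s) : u s ≤ N / s := by
  by_contra! hlt
  have hus : 0 < u s := lt_of_le_of_lt (by positivity) hlt
  have hpos : ∀ r ∈ Set.Icc 0 s, 0 < u r := fun r hr =>
    hus.trans_le (hanti hr.1 hs.le hr.2)
  have hNpos : 0 < N := by
    rcases hN.lt_or_eq with h | h
    · exact h
    · have := hu s hs hus.le
      rw [← h, zero_mul] at this
      nlinarith
  -- (1/u)' = g/u² ≥ 1/N, so 1/u grows at least linearly from a positive value at 0.
  have hmono : MonotoneOn (fun r => (u r)⁻¹ - r / N) (Set.Icc 0 s) := by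
    refine monotoneOn_of_hasDerivWithinAt_nonneg (convex_Icc 0 s) ?_
      (f' := fun r => g r / u r ^ 2 - 1 / N) (fun r hr => ?_) (fun r hr => ?_)
    · exact ((hc.mono fun r hr => hr.1).inv₀ fun r hr => (hpos r hr).ne').sub
        (continuousOn_id.div_const N)
    · rw [interior_Icc] at hr
      have h1 := ((hd r hr.1).inv (hpos r ⟨hr.1.le, hr.2.le⟩).ne').sub
        ((hasDerivAt_id r).div_const N)
      rw [neg_neg] at h1
      exact h1.hasDerivWithinAt
    · rw [interior_Icc] at hr
      have hp := hpos r ⟨hr.1.le, hr.2.le⟩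
      have := hu r hr.1 hp.le
      rw [sub_nonneg, div_le_div_iff₀ hNpos (by positivity)]
      linarith
  have h2 := hmono (Set.left_mem_Icc.2 hs.le) (Set.right_mem_Icc.2 hs.le) hs.le
  simp only [zero_div, sub_zero] at h2
  have h3 : 0 < (u 0)⁻¹ := inv_pos.2 (hpos 0 (Set.left_mem_Icc.2 hs.le))
  have h4 : s / N ≤ (u s)⁻¹ := by linarith
  have h5 := inv_anti₀ (by positivity) h4
  rw [inv_inv, inv_div] at h5
  linarith

/-- The basic on-diagonal upper bound, for a ball of arbitrary integer radius. -/
lemma IsTrapModel.heatKernel_le [IsProbabilityMeasure P] (h : IsTrapModel τ x P ℱ X)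
    (hτ : ∀ z, 1 ≤ τ z) {t : ℝ≥0} (ht : 0 < t) (N : ℕ) :
    heatKernel τ P X t x ≤ 1 / volume τ x N + 2 * N / t := by
  have htr : (0 : ℝ) < t := ht
  have hanti := h.antitoneOn_norm_sq_curve hτ
  have := le_div_of_sq_le_mul_neg_deriv (u := fun s => ‖h.curve hτ s‖ ^ 2 - 1 / volume τ x N)
    (g := fun s => ‖weightedGrad _ (abs_invSqrt_le hτ) (h.curve hτ s)‖ ^ 2) (N := N)
    (Nat.cast_nonneg N)
    (((h.curve_continuous_and_hasDerivAt hτ).1.norm.pow 2).sub continuous_const).continuousOn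
    (fun s hs => (h.hasDerivAt_norm_sq_curve hτ hs).sub_const _) (fun s hs hus => ?_)
    (fun a ha b hb hab => sub_le_sub_right (hanti ha hb hab) _) (half_pos htr)
  · rw [← h.heatKernel_eq_norm_sq hτ] at this
    rw [show (2 : ℝ) * N / t = N / (t / 2) by field_simp]
    linarith
  · lift s to ℝ≥0 using hs.le
    obtain ⟨y, hy, hyle⟩ := h.exists_heatKernel_le hτ s N
    have h1 := sq_sub_le_of_abs_sub_le (abs_invSqrt_le hτ) (h.curve hτ s) hy
    rw [h.weighted_curve_apply hτ, h.weighted_curve_apply hτ] at h1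
    refine le_trans ?_ h1
    -- The gradient estimate concerns p_s(x,x) = ‖m_{s/2}‖², while the differential inequality is
    -- for ‖m_s‖². Monotonicity passes from one to the other, and `hus` allows squaring.
    have h2 : ‖h.curve hτ s‖ ^ 2 ≤ heatKernel τ P X s x := by
      rw [h.heatKernel_eq_norm_sq hτ]
      exact hanti (half_pos hs).le hs.le (half_le_self hs.le)
    gcongr

end

/-! ### Tent functions, occupation time and the lower bound -/

section

/-- The Green function of `Δ / 2` on the interval of radius `R` about `0`, with pole `q`, is the
positive part of this function of `p`. -/
noncomputable def tent (R q p : ℝ) : ℝ := min ((p + R) * (R - q) / R) ((R - p) * (q + R) / R)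

lemma tent_of_le {R q p : ℝ} (hR : 0 < R) (h : p ≤ q) : tent R q p = (p + R) * (R - q) / R := by
  refine min_eq_left ?_
  gcongr ?_ / R
  nlinarith

lemma tent_of_ge {R q p : ℝ} (hR : 0 < R) (h : q ≤ p) : tent R q p = (R - p) * (q + R) / R := by
  refine min_eq_right ?_
  gcongr ?_ / R
  nlinarith

lemma tent_le {R q p : ℝ} (hR : 0 < R) (hq : |q| ≤ R) : tent R q p ≤ R := by
  obtain ⟨h1, h2⟩ := abs_le.1 hq
  rcases le_total p q with h | h
  · rw [tent_of_le hR h, div_le_iff₀ hR]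
    nlinarith [sq_nonneg q]
  · rw [tent_of_ge hR h, div_le_iff₀ hR]
    nlinarith [sq_nonneg q]

lemma tent_nonpos {R q p : ℝ} (hR : 0 < R) (hq : |q| ≤ R) (hp : R ≤ |p|) : tent R q p ≤ 0 := by
  obtain ⟨h1, h2⟩ := abs_le.1 hq
  rcases le_abs.1 hp with h | h
  · exact (min_le_right _ _).trans (div_nonpos_of_nonpos_of_nonneg
      (mul_nonpos_of_nonpos_of_nonneg (by linarith) (by linarith)) hR.le)
  · exact (min_le_left _ _).trans (div_nonpos_of_nonpos_of_nonneg
      (mul_nonpos_of_nonpos_of_nonneg (by linarith) (by linarith)) hR.le)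

lemma tent_zero {R q : ℝ} (hR : 0 < R) : tent R q 0 = R - |q| := by
  rcases le_total 0 q with h | h
  · rw [tent_of_le hR h, abs_of_nonneg h]
    field_simp
    ring
  · rw [tent_of_ge hR h, abs_of_nonpos h]
    field_simp
    ring

/-- Affine on each side of q, with slopes (R - q)/R and -(R + q)/R, which differ by 2. -/
lemma tent_laplacian {R : ℝ} (hR : 0 < R) (q p : ℤ) :
    tent R q ((p + 1 : ℤ) : ℝ) - tent R q p + (tent R q ((p - 1 : ℤ) : ℝ) - tent R q p)
      = if q = p then -2 else 0 := by
  rcases lt_trichotomy p q with h | h | h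
  · have h1 : ((p + 1 : ℤ) : ℝ) ≤ q := by exact_mod_cast h
    rw [if_neg h.ne', tent_of_le hR h1, tent_of_le hR (by exact_mod_cast h.le),
      tent_of_le hR (by exact_mod_cast (show p - 1 ≤ q by omega))]
    push_cast
    ring
  · subst h
    rw [if_pos rfl, tent_of_ge hR (by exact_mod_cast (show p ≤ p + 1 by omega)),
      tent_of_le hR le_rfl, tent_of_le hR (by exact_mod_cast (show p - 1 ≤ p by omega))]
    push_cast
    field_simp
    ring
  · have h1 : (q : ℝ) ≤ ((p - 1 : ℤ) : ℝ) := by exact_mod_cast (show q ≤ p - 1 by omega)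
    rw [if_neg h.ne, tent_of_ge hR h1,
      tent_of_ge hR (by exact_mod_cast (show q ≤ p + 1 by omega)),
      tent_of_ge hR (by exact_mod_cast h.le)]
    push_cast
    ring

/-- Truncation at 0 keeps the lower bound: where the tent is nonnegative only the neighbours can
rise, and elsewhere the truncation is at its minimum. -/
lemma le_max_tent_laplacian {R : ℝ} (hR : 0 < R) (q p : ℤ) :
    (if q = p then -2 else 0) ≤ max 0 (tent R q ((p + 1 : ℤ) : ℝ)) - max 0 (tent R q p) +
      (max 0 (tent R q ((p - 1 : ℤ) : ℝ)) - max 0 (tent R q p)) := by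
  have h1 := le_max_left 0 (tent R q ((p + 1 : ℤ) : ℝ))
  have h2 := le_max_right 0 (tent R q ((p + 1 : ℤ) : ℝ))
  have h3 := le_max_left 0 (tent R q ((p - 1 : ℤ) : ℝ))
  have h4 := le_max_right 0 (tent R q ((p - 1 : ℤ) : ℝ))
  rcases le_total 0 (tent R q p) with h | h
  · rw [← tent_laplacian hR, max_eq_right h]
    linarith
  · rw [max_eq_left h]
    split_ifs <;> linarith

/-- The expected time spent in the ball of radius `n` before leaving the ball of radius `2 n`,
as a function of the starting point. -/
noncomputable def occupationTime (τ : ℤ → ℝ≥0) (x : ℤ) (n : ℕ) (z : ℤ) : ℝ :=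
  ∑ y ∈ Finset.Icc (x - (n : ℤ)) (x + n),
    (τ y : ℝ) * max 0 (tent (2 * n + 1) ((y - x : ℤ) : ℝ) ((z - x : ℤ) : ℝ))

variable {τ : ℤ → ℝ≥0} {x : ℤ} {n : ℕ}

lemma abs_sub_le_of_mem_Icc {y : ℤ} (hy : y ∈ Finset.Icc (x - (n : ℤ)) (x + n)) :
    |((y - x : ℤ) : ℝ)| ≤ n := by
  rw [Finset.mem_Icc] at hy
  rw [← Int.cast_abs]
  have : |y - x| ≤ n := abs_le.2 ⟨by linarith [hy.1], by linarith [hy.2]⟩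
  exact_mod_cast this

lemma occupationTime_nonneg (z : ℤ) : 0 ≤ occupationTime τ x n z :=
  Finset.sum_nonneg fun _ _ => mul_nonneg (NNReal.coe_nonneg _) (le_max_left _ _)

lemma occupationTime_le (z : ℤ) : occupationTime τ x n z ≤ (2 * n + 1) * volume τ x n := by
  rw [volume_natCast, Finset.mul_sum]
  refine Finset.sum_le_sum fun y hy => ?_
  have := abs_sub_le_of_mem_Icc hy
  have hR : (0 : ℝ) < 2 * n + 1 := by positivity
  rw [mul_comm]
  gcongr
  exact max_le hR.le (tent_le hR (by linarith))

lemma le_occupationTime_self : (n + 1) * volume τ x n ≤ occupationTime τ x n x := by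
  rw [volume_natCast, Finset.mul_sum]
  refine Finset.sum_le_sum fun y hy => ?_
  have := abs_sub_le_of_mem_Icc hy
  rw [mul_comm]
  gcongr
  refine le_max_of_le_right ?_
  rw [sub_self, Int.cast_zero, tent_zero (by positivity)]
  linarith

/-- The tents have radius 2n + 1, so they are nonpositive at every integer point outside the closed
ball of radius 2n. -/
lemma occupationTime_eq_zero {z : ℤ} (hz : z ∉ Finset.Icc (x - (2 * n : ℕ)) (x + (2 * n : ℕ))) :
    occupationTime τ x n z = 0 := by
  refine Finset.sum_eq_zero fun y hy => ?_
  have h1 := abs_sub_le_of_mem_Icc hy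
  have h2 : (2 * n + 1 : ℝ) ≤ |((z - x : ℤ) : ℝ)| := by
    rw [← Int.cast_abs]
    have : (2 * n + 1 : ℤ) ≤ |z - x| := by
      rw [Finset.mem_Icc] at hz
      push_cast at hz
      rw [le_abs]
      omega
    exact_mod_cast this
  rw [max_eq_left (tent_nonpos (by positivity) (by linarith) h2), mul_zero]

/-- Only the tent with pole y = z can contribute negatively, by at most 2τ_z, which the factor
1/(2τ_z) in the generator normalises to 1. -/
lemma neg_one_le_generator_occupationTime (hτ : ∀ z, 1 ≤ τ z) (z : ℤ) :
    -1 ≤ generator τ (occupationTime τ x n) z := by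
  have hz : (0 : ℝ) < τ z := zero_lt_one.trans_le (show (1 : ℝ) ≤ τ z from hτ z)
  have h1 : -(2 * (τ z : ℝ)) ≤ occupationTime τ x n (z + 1) - occupationTime τ x n z +
      (occupationTime τ x n (z - 1) - occupationTime τ x n z) := by
    simp only [occupationTime, ← Finset.sum_sub_distrib, ← Finset.sum_add_distrib]
    calc -(2 * (τ z : ℝ))
        ≤ ∑ y ∈ Finset.Icc (x - (n : ℤ)) (x + n), if y = z then -(2 * (τ z : ℝ)) else 0 := by
          rw [Finset.sum_ite_eq']
          split_ifs
          · exact le_rfl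
          · linarith
      _ ≤ _ := Finset.sum_le_sum fun y _ => by
          have h2 := le_max_tent_laplacian (R := 2 * n + 1) (by positivity) (y - x) (z - x)
          rw [show z - x + 1 = z + 1 - x by ring, show z - x - 1 = z - 1 - x by ring] at h2
          have h3 := mul_le_mul_of_nonneg_left h2 (NNReal.coe_nonneg (τ y))
          simp only [sub_left_inj] at h3
          refine le_trans (le_of_eq ?_) (h3.trans (le_of_eq (by ring)))
          split_ifs with hyz
          · rw [hyz]; ring
          · ring
  rw [generator, one_div, inv_mul_eq_div, le_div_iff₀ (by positivity)]
  linarith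

variable {Ω : Type*} {mΩ : MeasurableSpace Ω}
    {P : Measure Ω} {ℱ : Filtration ℝ≥0 mΩ} {X : ℝ≥0 → Ω → ℤ}

/-- Dynkin's formula gives E G(X_s) ≥ G(x) - s for G = `occupationTime`, while E G(X_s) ≤ sup G ·
P(X_s ∈ B), as G vanishes off the ball B of radius 2n. -/
lemma IsTrapModel.sub_le_mul_sum_measureReal [IsProbabilityMeasure P]
    (h : IsTrapModel τ x P ℱ X) (hτ : ∀ z, 1 ≤ τ z) (n : ℕ) (s : ℝ≥0) :
    (n + 1) * volume τ x n - s ≤ (2 * n + 1) * volume τ x n *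
      ∑ y ∈ Finset.Icc (x - (2 * n : ℕ)) (x + (2 * n : ℕ)), P.real {ω | X s ω = y} := by
  have hb : ∀ z, |occupationTime τ x n z| ≤ (2 * n + 1) * volume τ x n := fun z => by
    rw [abs_of_nonneg (occupationTime_nonneg z)]
    exact occupationTime_le z
  have h1 := h.integral_comp_eq hτ hb s
  have h2 : -(s : ℝ) ≤ ∫ r in (0 : ℝ)..s, ∫ ω, generator τ (occupationTime τ x n)
      (X r.toNNReal ω) ∂P := by
    have h3 : ∀ r : ℝ, |∫ ω, generator τ (occupationTime τ x n) (X r.toNNReal ω) ∂P|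
        ≤ 2 * ((2 * n + 1) * volume τ x n) := fun r => by
      have := norm_integral_le_of_norm_le_const (μ := P)
        (f := fun ω => generator τ (occupationTime τ x n) (X r.toNNReal ω))
        (Eventually.of_forall fun ω => abs_generator_le hτ hb (X r.toNNReal ω))
      simpa using this
    have h4 : IntervalIntegrable (fun r : ℝ => ∫ ω, generator τ (occupationTime τ x n)
        (X r.toNNReal ω) ∂P) MeasureTheory.volume 0 s := by
      refine (intervalIntegrable_const (c := 2 * ((2 * n + 1) * (volume τ x n : ℝ)))).mono_fun
        (h.measurable_integral_comp _).aestronglyMeasurable (Eventually.of_forall fun r => ?_)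
      exact (h3 r).trans (le_abs_self _)
    have h5 := intervalIntegral.integral_mono_on (μ := MeasureTheory.volume) s.2
      (intervalIntegrable_const (c := (-1 : ℝ))) h4 fun r _ => by
        have := integral_mono (μ := P) (integrable_const (-1 : ℝ))
          (h.integrable_comp (abs_generator_le hτ hb) r.toNNReal)
          fun ω => neg_one_le_generator_occupationTime hτ _
        simpa using this
    simpa using h5
  have h6 : ∫ ω, occupationTime τ x n (X s ω) ∂P ≤ (2 * n + 1) * volume τ x n *
      ∑ y ∈ Finset.Icc (x - (2 * n : ℕ)) (x + (2 * n : ℕ)), P.real {ω | X s ω = y} := by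
    rw [← (h.hasSum_integral_comp hb s).tsum_eq, tsum_eq_sum fun y hy => by
      rw [occupationTime_eq_zero hy, mul_zero], Finset.mul_sum]
    refine Finset.sum_le_sum fun y _ => ?_
    rw [mul_comm]
    exact mul_le_mul_of_nonneg_right (occupationTime_le y) measureReal_nonneg
  have h7 := le_occupationTime_self (τ := τ) (x := x) (n := n)
  linarith

/-- Cauchy–Schwarz for P(X_s = y) = m_s(y) · √τ_y, with ‖m_s‖² = p_{2s}(x,x). -/
lemma IsTrapModel.sq_sum_measureReal_le [IsProbabilityMeasure P]
    (h : IsTrapModel τ x P ℱ X) (hτ : ∀ z, 1 ≤ τ z) (s : ℝ≥0) (B : Finset ℤ) :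
    (∑ y ∈ B, P.real {ω | X s ω = y}) ^ 2 ≤ heatKernel τ P X (2 * s) x * ∑ y ∈ B, (τ y : ℝ) := by
  have h1 : ∀ y, P.real {ω | X s ω = y} = h.curve hτ s y * √(τ y : ℝ) := fun y => by
    have : (0 : ℝ) < √(τ y : ℝ) := Real.sqrt_pos.2 (zero_lt_one.trans_le
      (show (1 : ℝ) ≤ τ y from hτ y))
    rw [curve, occupation_apply, Real.toNNReal_coe, invSqrt, inv_mul_cancel_right₀ this.ne']
  simp only [h1]
  refine (Finset.sum_mul_sq_le_sq_mul_sq _ _ _).trans ?_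
  simp only [Real.sq_sqrt (NNReal.coe_nonneg _)]
  gcongr
  rw [h.heatKernel_eq_norm_sq hτ, NNReal.coe_mul, NNReal.coe_ofNat,
    mul_div_cancel_left₀ _ (two_ne_zero)]
  have h2 := lp.sum_rpow_le_norm_rpow (p := 2) (by norm_num) (h.curve hτ s) B
  simpa only [ENNReal.toReal_ofNat, Real.rpow_ofNat, Real.norm_eq_abs, sq_abs] using h2

lemma IsTrapModel.le_heatKernel [IsProbabilityMeasure P]
    (h : IsTrapModel τ x P ℱ X) (hτ : ∀ z, 1 ≤ τ z) (n : ℕ) :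
    (volume τ x n : ℝ) ^ 2 / (16 * (volume τ x (2 * n) : ℝ) ^ 3)
      ≤ heatKernel τ P X ((n : ℝ≥0) / 2 * volume τ x n) x := by
  have hV : (0 : ℝ) < volume τ x n := volume_pos hτ x n
  have hW : (volume τ x n : ℝ) ≤ volume τ x (2 * n) := by
    exact NNReal.coe_le_coe.2 (volume_mono τ x (le_mul_of_one_le_left zero_le one_le_two))
  have h1 := h.sub_le_mul_sum_measureReal hτ n ((n : ℝ≥0) / 4 * volume τ x n)
  have h2 := h.sq_sum_measureReal_le hτ ((n : ℝ≥0) / 4 * volume τ x n)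
    (Finset.Icc (x - (2 * n : ℕ)) (x + (2 * n : ℕ)))
  rw [← volume_natCast, show 2 * ((n : ℝ≥0) / 4 * volume τ x n) = (n : ℝ≥0) / 2 * volume τ x n by
    rw [← mul_assoc]; congr 1; rw [← NNReal.coe_inj]; push_cast; ring] at h2
  push_cast at h1 h2
  set p := heatKernel τ P X ((n : ℝ≥0) / 2 * volume τ x n) x
  set S := ∑ y ∈ Finset.Icc (x - (2 * n : ℤ)) (x + (2 * n : ℤ)),
    P.real {ω | X ((n : ℝ≥0) / 4 * volume τ x n) ω = y}
  set V : ℝ := (volume τ x n : ℝ)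
  set W : ℝ := (volume τ x (2 * n) : ℝ)
  have hn : (0 : ℝ) ≤ n := Nat.cast_nonneg n
  -- At s = nV/4 the exit estimate reads S ≥ (3n/4 + 1)/(2n + 1), which is more than 1/4, also for n
  -- = 0.
  have h3 : 1 / 4 ≤ S := by
    have h4 : V * ((n + 1) - n / 4) ≤ V * ((2 * n + 1) * S) := by linarith
    have h5 := le_of_mul_le_mul_left h4 hV
    nlinarith
  have h6 : 1 / 16 ≤ p * W := by nlinarith
  have hWpos : 0 < W := hV.trans_le hW
  rw [div_le_iff₀ (by positivity)]
  -- The argument yields p ≥ 1/(16 W); the stated form follows from V ≤ W.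
  have h7 : V ^ 2 ≤ W ^ 2 := by gcongr
  nlinarith [mul_le_mul_of_nonneg_right h6 (sq_nonneg W)]

/-! ### Inverting r V_l(r) and choosing the radius -/

lemma pos_of_doubling {V : ℝ≥0 → ℝ≥0} {C : ℝ≥0} (hmono : Monotone V) (hne : V ≠ 0)
    (hdbl : ∀ r, V (2 * r) ≤ C * V r) {r : ℝ≥0} (hr : 0 < r) : 0 < V r := by
  obtain ⟨r₀, hr₀⟩ := Function.ne_iff.1 hne
  -- A zero of V at some r > 0 would propagate by doubling to all larger radii, and by monotonicity
  -- to r₀.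
  have hiter : ∀ k : ℕ, V (2 ^ k * r) ≤ C ^ k * V r := by
    intro k
    induction k with
    | zero => simp
    | succ k ih =>
      rw [pow_succ', pow_succ', mul_assoc, mul_assoc]
      exact (hdbl _).trans (by gcongr)
  obtain ⟨k, hk⟩ := pow_unbounded_of_one_lt (r₀ / r) (one_lt_two (α := ℝ≥0))
  rw [div_lt_iff₀ hr] at hk
  rw [pos_iff_ne_zero]
  intro h0
  have := (hmono hk.le).trans (hiter k)
  rw [h0, mul_zero] at this
  exact hr₀ (le_antisymm this zero_le)

lemma bijective_mul_self {V : ℝ≥0 → ℝ≥0} (hc : Continuous V) (hmono : Monotone V)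
    (hpos : ∀ r, 0 < r → 0 < V r) : Function.Bijective fun r => r * V r := by
  constructor
  · refine StrictMono.injective fun a b hab => ?_
    calc a * V a ≤ a * V b := by gcongr; exact hmono hab.le
      _ < b * V b := mul_lt_mul_of_pos_right hab (hpos b (zero_le.trans_lt hab))
  · intro t
    set R := max 1 (t / V 1)
    have h1 : t ∈ Set.Icc (0 * V 0) (R * V R) := by
      refine ⟨by simp, ?_⟩
      calc t = t / V 1 * V 1 := (div_mul_cancel₀ _ (hpos 1 one_pos).ne').symm
        _ ≤ R * V R := mul_le_mul' (le_max_right _ _) (hmono (le_max_left _ _))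
    obtain ⟨r, -, hr⟩ := intermediate_value_Icc (f := fun r => r * V r) (zero_le : 0 ≤ R)
      (by fun_prop) h1
    exact ⟨r, hr⟩

/-- Take N = ⌊r⌋, which leaves the volume unchanged. Since r v = t, 1/v equals r/t, so the two terms
add up to 3r/t. -/
lemma IsTrapModel.heatKernel_le_of_mul_eq [IsProbabilityMeasure P]
    (h : IsTrapModel τ x P ℱ X) (hτ : ∀ z, 1 ≤ τ z) {r v t : ℝ≥0} (ht : 0 < t)
    (hv : v ≤ volume τ x r) (hrv : r * v = t) : heatKernel τ P X t x ≤ 3 * r / t := by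
  have htr : (0 : ℝ) < t := ht
  have hv0 : 0 < v := pos_of_mul_pos_right (hrv ▸ ht) zero_le
  have hvr : (0 : ℝ) < v := hv0
  have h1 := h.heatKernel_le hτ ht ⌊r⌋₊
  have h2 : (v : ℝ) ≤ volume τ x (⌊r⌋₊ : ℝ≥0) := by
    have : volume τ x (⌊r⌋₊ : ℝ≥0) = volume τ x r := by simp [volume]
    rw [this]
    exact_mod_cast hv
  have h3 : (⌊r⌋₊ : ℝ) ≤ r := by exact_mod_cast Nat.floor_le (zero_le : 0 ≤ r)
  have h4 : (r : ℝ) * v = t := by exact_mod_cast hrv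
  calc heatKernel τ P X t x ≤ 1 / v + 2 * r / t := h1.trans (by gcongr)
    _ = 3 * r / t := by
      rw [← h4] at htr ⊢
      have : (r : ℝ) ≠ 0 := left_ne_zero_of_mul htr.ne'
      field_simp
      ring

/-- With N = n - 1 and t = 2nV(x,n), the term 2N/t is at most 1/V(x,n) ≤ 1/V(x,n-1), so both terms
have the same bound. -/
lemma IsTrapModel.heatKernel_le_two_div [IsProbabilityMeasure P]
    (h : IsTrapModel τ x P ℱ X) (hτ : ∀ z, 1 ≤ τ z) {n : ℕ} (hn : 1 ≤ n) :
    heatKernel τ P X (2 * n * volume τ x n) x ≤ 2 / (volume τ x ((n - 1 : ℕ) : ℝ≥0) : ℝ) := by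
  have hV : (0 : ℝ) < volume τ x ((n - 1 : ℕ) : ℝ≥0) := volume_pos hτ x _
  have hle : (volume τ x ((n - 1 : ℕ) : ℝ≥0) : ℝ) ≤ volume τ x n := by
    exact_mod_cast volume_mono τ x (by exact_mod_cast Nat.sub_le n 1)
  have hn0 : (0 : ℝ) < n := by exact_mod_cast hn
  have hn1 : ((n - 1 : ℕ) : ℝ) ≤ n := by exact_mod_cast Nat.sub_le n 1
  have ht : 0 < 2 * (n : ℝ≥0) * volume τ x n :=
    mul_pos (mul_pos two_pos (by exact_mod_cast hn)) (volume_pos hτ x _)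
  refine (h.heatKernel_le hτ ht (n - 1)).trans ?_
  simp only [NNReal.coe_mul, NNReal.coe_ofNat, NNReal.coe_natCast]
  have h1 : 2 * ((n - 1 : ℕ) : ℝ) / (2 * n * volume τ x n)
      ≤ 1 / volume τ x ((n - 1 : ℕ) : ℝ≥0) := by
    rw [div_le_div_iff₀ (mul_pos (by positivity) (hV.trans_le hle)) hV, one_mul]
    gcongr
  calc _ ≤ 1 / (volume τ x ((n - 1 : ℕ) : ℝ≥0) : ℝ) + 1 / volume τ x ((n - 1 : ℕ) : ℝ≥0) := by
        gcongr
    _ = _ := by ring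

end

end BTM

theorem proposition3p1 :
    -- upper bound from a doubling lower volume bound; `c` depends only on `C`
    (∀ C : ℝ≥0, ∃ c : ℝ≥0,
      ∀ (τ : ℤ → ℝ≥0), (∀ z, 1 ≤ τ z) →
      ∀ (x : ℤ) (Ω : Type*) (mΩ : MeasurableSpace Ω) (P : Measure Ω) (ℱ : Filtration ℝ≥0 mΩ)
        (X : ℝ≥0 → Ω → ℤ), IsProbabilityMeasure P → BTM.IsTrapModel τ x P ℱ X →
      ∀ Vl : ℝ≥0 → ℝ≥0, Continuous Vl → Monotone Vl → Vl ≠ 0 →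
        (∀ r, Vl (2 * r) ≤ C * Vl r) → (∀ r, Vl r ≤ BTM.volume τ x r) →
        Function.Bijective (fun r => r * Vl r) ∧
        ∀ t : ℝ≥0, 0 < t →
          BTM.heatKernel τ P X t x ≤ c * (Function.invFun (fun r => r * Vl r) t : ℝ≥0) / t) ∧
    -- upper and lower bound at volume-dependent times
    (∀ (τ : ℤ → ℝ≥0), (∀ z, 1 ≤ τ z) →
      ∀ (x : ℤ) (Ω : Type*) (mΩ : MeasurableSpace Ω) (P : Measure Ω) (ℱ : Filtration ℝ≥0 mΩ)
        (X : ℝ≥0 → Ω → ℤ), IsProbabilityMeasure P → BTM.IsTrapModel τ x P ℱ X →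
      (∀ n : ℕ, 1 ≤ n →
        BTM.heatKernel τ P X (2 * n * BTM.volume τ x n) x
          ≤ 2 / (BTM.volume τ x ((n - 1 : ℕ) : ℝ≥0) : ℝ)) ∧
      (∀ n : ℕ,
        (BTM.volume τ x n : ℝ) ^ 2 / (16 * (BTM.volume τ x (2 * n) : ℝ) ^ 3)
          ≤ BTM.heatKernel τ P X ((n : ℝ≥0) / 2 * BTM.volume τ x n) x)) := by
  -- The constant 3 serves for every C: doubling enters only through the positivity of V_l on (0,
  -- ∞), hence the bijectivity of h_l.
  refine ⟨fun C => ⟨3, ?_⟩, ?_⟩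
  · intro τ hτ x Ω mΩ P ℱ X hP h Vl hc hmono hne hdbl hle
    have hbij := BTM.bijective_mul_self hc hmono fun r hr => BTM.pos_of_doubling hmono hne hdbl hr
    refine ⟨hbij, fun t ht => ?_⟩
    exact h.heatKernel_le_of_mul_eq hτ ht (hle _) (Function.invFun_eq (hbij.2 t))
  · intro τ hτ x Ω mΩ P ℱ X hP h
    exact ⟨fun n hn => h.heatKernel_le_two_div hτ hn, fun n => h.le_heatKernel hτ n⟩
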